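/- Let $(\Omega,\Sigma,\mu)$ be a measure space, let $L^0(\Omega)$ be the $*$-algebra of (almost everywhere classes of) complex measurable functions on $\Omega$ with pointwise operations, and let $L^\infty(\Omega)\subseteq L^0(\Omega)$ be the algebra of essentially bounded functions. Let $A$ be a $*$-subalgebra of $L^0(\Omega)$ with $L^\infty(\Omega)\subseteq A$. Let $E$ be a locally bounded weak Fréchet $L^\infty(\Omega)$-bimodule containing $A$, that is: - $E$ is a complex topological linear space whose topology is given by a complete translation-invariant metric (local convexity is not assumed), and $0\in E$ has a bounded neighbourhood, i.e. one that is absorbed by every neighbourhood of $0$; - $E$ has commuting bilinear left and right actions $(a,x)\mapsto a\cdot x$ and $(a,x)\mapsto x\cdot a$ of $L^\infty(\Omega)$ with $a\cdot(b\cdot x)=(ab)\cdot x$ and $(x\cdot a)\cdot b=x\cdot(ab)$, and for each fixed $a\in L^\infty(\Omega)$ the maps $x\mapsto a\cdot x$ and $x\mapsto x\cdot a$ are continuous on $E$; - $A\subseteq E$ as a linear subspace (up to an injective linear map $A\to E$), and for $a\in L^\infty(\Omega)$, $x\in A$ the elements $a\cdot x$ and $x\cdot a$ of $E$ are the products $ax$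 and $xa$ in $A$. Then every derivation on $A$, i.e. every complex-linear map $D:A\to A$ with $D(xy)=D(x)y+xD(y)$ for all $x,y\in A$, is identically zero. -/

import Mathlib

open MeasureTheory Topology
open scoped ENNReal

/-! ## The algebra of measurable functions

Mathlib's `Ω →ₘ[μ] ℂ` is the space `L⁰(Ω)` of complex measurable functions modulo equality almost
everywhere. Mathlib provides its module structure, multiplication and involution (all pointwise);
the instances below only assemble them into a commutative complex star-algebra. -/

section LZero

variable {Ω : Type*} [MeasurableSpace Ω] {μ : Measure Ω}

theorem LZero.mul_add_aux (f g h : Ω →ₘ[μ] ℂ) : f * (g + h) = f * g + f * h := by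
  induction f, g, h using AEEqFun.induction_on₃ with
  | H f hf g hg h hh =>
    simp only [AEEqFun.mk_mul_mk, AEEqFun.mk_add_mk, mul_add]

theorem LZero.zero_mul_aux (f : Ω →ₘ[μ] ℂ) : 0 * f = 0 := by
  induction f using AEEqFun.induction_on with
  | H f hf => simp only [AEEqFun.zero_def, AEEqFun.mk_mul_mk]; congr 1; ext; simp

noncomputable instance LZero.instCommRing : CommRing (Ω →ₘ[μ] ℂ) :=
  { AEEqFun.instAddCommGroup, AEEqFun.instCommMonoid with
    left_distrib := LZero.mul_add_aux
    right_distrib := fun f g h => by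
      rw [mul_comm, LZero.mul_add_aux, mul_comm h f, mul_comm h g]
    zero_mul := LZero.zero_mul_aux
    mul_zero := fun f => by rw [mul_comm, LZero.zero_mul_aux] }

noncomputable instance LZero.instAlgebra : Algebra ℂ (Ω →ₘ[μ] ℂ) :=
  Algebra.ofModule
    (fun c f g => by
      induction f, g using AEEqFun.induction_on₂ with
      | H f hf g hg => simp only [AEEqFun.smul_mk, AEEqFun.mk_mul_mk, smul_mul_assoc])
    (fun c f g => by
      induction f, g using AEEqFun.induction_on₂ with
      | H f hf g hg => simp only [AEEqFun.smul_mk, AEEqFun.mk_mul_mk, mul_smul_comm])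

noncomputable instance LZero.instStarRing : StarRing (Ω →ₘ[μ] ℂ) where
  star_mul f g := by
    apply AEEqFun.ext
    filter_upwards [AEEqFun.coeFn_star (f * g), AEEqFun.coeFn_star f, AEEqFun.coeFn_star g,
      AEEqFun.coeFn_mul f g, AEEqFun.coeFn_mul (star g) (star f)] with x h1 h2 h3 h4 h5
    simp only [h1, h2, h3, h4, h5, Pi.star_apply, Pi.mul_apply, star_mul]
  star_add f g := by
    apply AEEqFun.ext
    filter_upwards [AEEqFun.coeFn_star (f + g), AEEqFun.coeFn_star f, AEEqFun.coeFn_star g,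
      AEEqFun.coeFn_add f g, AEEqFun.coeFn_add (star f) (star g)] with x h1 h2 h3 h4 h5
    simp only [h1, h2, h3, h4, h5, Pi.star_apply, Pi.add_apply, star_add]

instance LZero.instStarModule : StarModule ℂ (Ω →ₘ[μ] ℂ) where
  star_smul c f := by
    apply AEEqFun.ext
    filter_upwards [AEEqFun.coeFn_star (c • f), AEEqFun.coeFn_star f,
      AEEqFun.coeFn_smul c f, AEEqFun.coeFn_smul (star c) (star f)] with x h1 h2 h3 h4
    simp only [h1, h2, h3, h4, Pi.star_apply, Pi.smul_apply, star_smul]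

variable (μ) in
/-- `L^∞(Ω)`: the star-subalgebra of `L⁰(Ω)` of essentially bounded functions. -/
noncomputable def LInfinity : StarSubalgebra ℂ (Ω →ₘ[μ] ℂ) where
  carrier := {f | f ∈ Lp ℂ ∞ μ}
  mul_mem' := fun {f g} hf hg => by
    have hf' : MemLp f ∞ μ := Lp.mem_Lp_iff_memLp.1 hf
    have hg' : MemLp g ∞ μ := Lp.mem_Lp_iff_memLp.1 hg
    exact Lp.mem_Lp_iff_memLp.2 ((hg'.mul hf').ae_eq (AEEqFun.coeFn_mul f g).symm)
  add_mem' := fun {f g} hf hg => (Lp ℂ ∞ μ).add_mem hf hg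
  algebraMap_mem' := fun c => by
    have h : (algebraMap ℂ (Ω →ₘ[μ] ℂ) c) = AEEqFun.mk (fun _ => c) aestronglyMeasurable_const := by
      rw [Algebra.algebraMap_eq_smul_one, AEEqFun.one_def, AEEqFun.smul_mk]
      congr 1
      ext x
      simp
    rw [Set.mem_ofPred_eq, h]
    exact Lp.mem_Lp_iff_memLp.2
      ((memLp_top_const c).ae_eq (AEEqFun.coeFn_mk _ _).symm)
  star_mem' := fun {f} hf => (star (⟨f, hf⟩ : Lp ℂ ∞ μ)).2

end LZero

/-! ## Bimodules -/

/-- The structure of a `B`-bimodule on a complex linear space `E`, for a complex algebra `B`: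
`left a x` is `a · x` and `right a x` is `x · a`. Both actions are bilinear;
the identity of `B` (if there is one) is not required to act as the identity. -/
structure AlgebraBimodule (B E : Type*) [NonUnitalRing B] [Module ℂ B]
    [AddCommGroup E] [Module ℂ E] where
  left : B →ₗ[ℂ] E →ₗ[ℂ] E
  right : B →ₗ[ℂ] E →ₗ[ℂ] E
  left_left : ∀ (a b : B) (x : E), left a (left b x) = left (a * b) x
  right_right : ∀ (a b : B) (x : E), right b (right a x) = right (a * b) x
  left_right : ∀ (a b : B) (x : E), left a (right b x) = right b (left a x)

/-- A Fréchet space in the sense of a complete metrizable topological linear space whose metric is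
shift invariant (no local convexity). Continuity of addition follows from shift invariance. -/
structure IsFrechetSpace (E : Type*) [AddCommGroup E] [Module ℂ E] [MetricSpace E] : Prop where
  dist_add_right : ∀ x y z : E, dist (x + z) (y + z) = dist x y
  complete : CompleteSpace E
  continuous_smul : ContinuousSMul ℂ E

/-- A weak Fréchet `B`-bimodule: a Fréchet space with a `B`-bimodule structure for which
`x ↦ a · x` and `x ↦ x · a` are continuous for each fixed `a`. -/
structure WeakFrechetBimodule (B E : Type*) [NonUnitalRing B] [Module ℂ B]
    [AddCommGroup E] [Module ℂ E] [MetricSpace E] extends AlgebraBimodule B E where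
  isFrechetSpace : IsFrechetSpace E
  continuous_left : ∀ a : B, Continuous (fun x : E => left a x)
  continuous_right : ∀ a : B, Continuous (fun x : E => right a x)

/-- A topological linear space is locally bounded if it has a bounded neighbourhood of zero
(bounded: absorbed by every neighbourhood of zero). -/
def IsLocallyBounded (E : Type*) [AddCommGroup E] [Module ℂ E] [TopologicalSpace E] : Prop :=
  ∃ U ∈ 𝓝 (0 : E), Bornology.IsVonNBounded ℂ U

/-- A realization of the inclusion `A ⊆ E` of an algebra `A` of measurable functions containing
`L^∞(Ω)` in an `L^∞(Ω)`-bimodule `E`: an injective complex-linear map `A → E` that carries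
multiplication in `A` by elements of `L^∞(Ω)` to the two actions on `E`. -/
structure BimoduleInclusion {Ω : Type*} [MeasurableSpace Ω] {μ : Measure Ω}
    (A : StarSubalgebra ℂ (Ω →ₘ[μ] ℂ)) (hA : LInfinity μ ≤ A)
    {E : Type*} [AddCommGroup E] [Module ℂ E] (M : AlgebraBimodule (LInfinity μ) E) where
  toLinearMap : A →ₗ[ℂ] E
  injective : Function.Injective toLinearMap
  map_left : ∀ (a : LInfinity μ) (x : A),
    toLinearMap (StarSubalgebra.inclusion hA a * x) = M.left a (toLinearMap x)
  map_right : ∀ (a : LInfinity μ) (x : A),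
    toLinearMap (x * StarSubalgebra.inclusion hA a) = M.right a (toLinearMap x)

open scoped Pointwise

section

variable {Ω : Type*} [MeasurableSpace Ω] {μ : Measure Ω}

/-! A derivation kills idempotents, so it is local and sees a function on a measurable set only up
to constants. Subtracting locally constant Gaussian integers from a rescaled `x` therefore makes it
bounded without changing its derivative. Hence one bounded `c` can have `D c = r n • D x` on the
n-th piece of a partition, with arbitrary scales `r n`. If `D x ≠ 0`, locality forbids `x` to have
atoms on the support of `D x`, so some partition has infinitely many pieces meeting that support.
Taking `r n` so large that `r n • p n · D x` leaves the n-th dilate of a bounded neighbourhood, cut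
by `p n`, contradicts the absorption of the single vector `D c` by these dilates. -/

theorem mem_LInfinity_mk {f : Ω → ℂ} (hf : AEStronglyMeasurable f μ) (C : ℝ)
    (hC : ∀ ω, ‖f ω‖ ≤ C) : AEEqFun.mk f hf ∈ LInfinity μ :=
  Lp.mem_Lp_iff_memLp.2
    ((memLp_top_of_bound hf C (Filter.Eventually.of_forall hC)).ae_eq (AEEqFun.coeFn_mk _ _).symm)

/-- The indicator function of a measurable set, as an element of `L^∞`. -/
noncomputable def LInfinity.indicator {S : Set Ω} (hS : MeasurableSet S) : LInfinity μ :=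
  ⟨AEEqFun.mk (S.indicator fun _ => (1 : ℂ))
      (stronglyMeasurable_const.indicator hS).aestronglyMeasurable,
    mem_LInfinity_mk _ 1 fun ω => by
      by_cases h : ω ∈ S <;> simp [h]⟩

theorem LInfinity.coeFn_indicator {S : Set Ω} (hS : MeasurableSet S) :
    ((LInfinity.indicator hS : LInfinity μ) : Ω →ₘ[μ] ℂ) =ᵐ[μ] S.indicator fun _ => (1 : ℂ) :=
  AEEqFun.coeFn_mk _ _

theorem LInfinity.indicator_mul_eq_iff {S : Set Ω} (hS : MeasurableSet S) (f g : Ω →ₘ[μ] ℂ) :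
    (LInfinity.indicator hS : LInfinity μ) * f = (LInfinity.indicator hS : LInfinity μ) * g ↔
      ∀ᵐ ω ∂μ, ω ∈ S → f ω = g ω := by
  rw [AEEqFun.ext_iff]
  have h1 := AEEqFun.coeFn_mul (LInfinity.indicator hS : LInfinity μ).1 f
  have h2 := AEEqFun.coeFn_mul (LInfinity.indicator hS : LInfinity μ).1 g
  have h3 := LInfinity.coeFn_indicator (μ := μ) hS
  constructor
  · intro h
    filter_upwards [h, h1, h2, h3] with ω h h1 h2 h3 hω
    rw [h1, h2] at h
    simpa [h3, hω] using h
  · intro h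
    filter_upwards [h, h1, h2, h3] with ω h h1 h2 h3
    rw [h1, h2]
    by_cases hω : ω ∈ S
    · simp [h hω]
    · simp [h3, hω]

theorem LInfinity.isIdempotentElem_indicator {S : Set Ω} (hS : MeasurableSet S) :
    IsIdempotentElem (LInfinity.indicator hS : LInfinity μ) := by
  apply Subtype.ext
  change (LInfinity.indicator hS : LInfinity μ).1 * (LInfinity.indicator hS : LInfinity μ).1 =
    (LInfinity.indicator hS : LInfinity μ).1
  conv_rhs => rw [← mul_one (LInfinity.indicator hS : LInfinity μ).1]
  rw [LInfinity.indicator_mul_eq_iff]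
  filter_upwards [LInfinity.coeFn_indicator (μ := μ) hS,
    AEEqFun.coeFn_one (α := Ω) (μ := μ) (β := ℂ)] with ω h1 h2 hω
  rw [h1, h2]
  simp [hω]

/-- The Leibniz rule on `p² = p` gives `(2p - 1) Dp = 0`, and `(2p - 1)² = 1`. -/
theorem Derivation.apply_eq_zero_of_isIdempotentElem {R B : Type*} [CommRing R] [CommRing B]
    [Algebra R B] (D : Derivation R B B) {p : B} (hp : IsIdempotentElem p) : D p = 0 := by
  have hp' : p * p = p := hp
  have h := congrArg D hp'
  rw [D.leibniz, smul_eq_mul] at h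
  linear_combination (2 * p - 1) * h - 4 * D p * hp'

/-- A derivation commutes with affine relations that hold on a measurable set. -/
theorem Derivation.ae_eq_of_affine_on {A : StarSubalgebra ℂ (Ω →ₘ[μ] ℂ)} (hA : LInfinity μ ≤ A)
    (D : Derivation ℂ A A) (f g : A) (k w : ℂ) {S : Set Ω} (hS : MeasurableSet S)
    (h : ∀ᵐ ω ∂μ, ω ∈ S → f.1 ω = k * g.1 ω + w) :
    ∀ᵐ ω ∂μ, ω ∈ S → (D f).1 ω = k * (D g).1 ω := by
  set p : A := StarSubalgebra.inclusion hA (LInfinity.indicator hS) with hp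
  have hDp : D p = 0 := D.apply_eq_zero_of_isIdempotentElem
    ((LInfinity.isIdempotentElem_indicator hS).map (StarSubalgebra.inclusion hA))
  have hpf : p * f = p * (k • g + w • (1 : A)) := by
    apply Subtype.ext
    change (LInfinity.indicator hS : LInfinity μ).1 * f.1 =
      (LInfinity.indicator hS : LInfinity μ).1 * (k • g.1 + w • (1 : Ω →ₘ[μ] ℂ))
    rw [LInfinity.indicator_mul_eq_iff]
    filter_upwards [h, AEEqFun.coeFn_add (k • g.1) (w • (1 : Ω →ₘ[μ] ℂ)),
      AEEqFun.coeFn_smul k g.1, AEEqFun.coeFn_smul w (1 : Ω →ₘ[μ] ℂ),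
      AEEqFun.coeFn_one (α := Ω) (μ := μ) (β := ℂ)] with ω h h1 h2 h3 h4 hω
    rw [h hω, h1, Pi.add_apply, h2, h3, Pi.smul_apply, Pi.smul_apply, h4]
    simp
  have hD := congrArg D hpf
  rw [D.leibniz, D.leibniz, hDp, smul_zero, smul_zero, add_zero, add_zero, map_add, D.map_smul,
    D.map_smul, D.map_one_eq_zero, smul_zero, add_zero, smul_eq_mul, smul_eq_mul] at hD
  have hD' := congrArg Subtype.val hD
  change (LInfinity.indicator hS : LInfinity μ).1 * (D f).1 =
      (LInfinity.indicator hS : LInfinity μ).1 * (k • (D g).1) at hD'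
  rw [LInfinity.indicator_mul_eq_iff] at hD'
  filter_upwards [hD', AEEqFun.coeFn_smul k (D g).1] with ω h1 h2 hω
  rw [h1 hω, h2]
  rfl

/-- The fractional parts of the coordinates of `r • z`. -/
noncomputable def Complex.fractSMul (r : ℝ) (z : ℂ) : ℂ :=
  ((Int.fract (r * z.re) : ℝ) : ℂ) + ((Int.fract (r * z.im) : ℝ) : ℂ) * Complex.I

/-- Wherever both floors are constant, this is affine in `z` with slope `r`. -/
theorem Complex.fractSMul_eq (r : ℝ) (z : ℂ) :
    Complex.fractSMul r z =
      r * z + -((⌊r * z.re⌋ : ℂ) + (⌊r * z.im⌋ : ℂ) * Complex.I) := by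
  unfold Complex.fractSMul
  simp only [Int.fract]
  push_cast
  linear_combination (r : ℂ) * Complex.re_add_im z

theorem Complex.norm_fractSMul_le (r : ℝ) (z : ℂ) : ‖Complex.fractSMul r z‖ ≤ 2 := by
  refine (norm_add_le _ _).trans ?_
  rw [norm_mul, Complex.norm_I, mul_one, Complex.norm_real, Complex.norm_real, Real.norm_eq_abs,
    Real.norm_eq_abs, Int.abs_fract, Int.abs_fract]
  linarith [Int.fract_lt_one (r * z.re), Int.fract_lt_one (r * z.im)]

theorem Complex.measurable_fractSMul (r : ℝ) : Measurable (Complex.fractSMul r) := by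
  unfold Complex.fractSMul
  fun_prop

/-- For countably many scales `r n` on the pieces `{N = n}` of a measurable partition, some
bounded function has the derivative `r N • D a`. -/
theorem Derivation.exists_LInfinity_apply_ae_eq {A : StarSubalgebra ℂ (Ω →ₘ[μ] ℂ)}
    (hA : LInfinity μ ≤ A) (D : Derivation ℂ A A) (a : A) {N : Ω → ℕ} (hN : Measurable N)
    (r : ℕ → ℝ) : ∃ c : A, ∀ᵐ ω ∂μ, (D c).1 ω = r (N ω) * (D a).1 ω := by
  have hα : Measurable (a.1 : Ω → ℂ) := AEEqFun.measurable a.1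
  have hφ : Measurable fun ω => Complex.fractSMul (r (N ω)) (a.1 ω) := by
    have h : Measurable fun q : ℕ × ℂ => Complex.fractSMul (r q.1) q.2 :=
      measurable_from_prod_countable_right fun n => Complex.measurable_fractSMul (r n)
    exact h.comp (hN.prodMk hα)
  let c : A := StarSubalgebra.inclusion hA
    ⟨AEEqFun.mk _ hφ.aestronglyMeasurable,
      mem_LInfinity_mk _ 2 fun ω => Complex.norm_fractSMul_le _ _⟩
  have hc : (c.1 : Ω → ℂ) =ᵐ[μ] fun ω => Complex.fractSMul (r (N ω)) (a.1 ω) :=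
    AEEqFun.coeFn_mk _ _
  refine ⟨c, ?_⟩
  -- The joint level sets of `N` and the two floors are countably many and cover `Ω`.
  have key : ∀ n : ℕ, ∀ j l : ℤ, ∀ᵐ ω ∂μ,
      ω ∈ {ω | N ω = n ∧ ⌊r n * (a.1 ω).re⌋ = j ∧ ⌊r n * (a.1 ω).im⌋ = l} →
        (D c).1 ω = (r n : ℂ) * (D a).1 ω := by
    intro n j l
    refine D.ae_eq_of_affine_on hA c a (r n) (-((j : ℂ) + (l : ℂ) * Complex.I)) ?_ ?_
    · have h1 : Measurable fun ω => ⌊r n * (a.1 ω).re⌋ :=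
        ((Complex.measurable_re.comp hα).const_mul _).floor
      have h2 : Measurable fun ω => ⌊r n * (a.1 ω).im⌋ :=
        ((Complex.measurable_im.comp hα).const_mul _).floor
      exact (hN (measurableSet_singleton n)).inter
        ((h1 (measurableSet_singleton j)).inter (h2 (measurableSet_singleton l)))
    · filter_upwards [hc] with ω h ⟨hn, hj, hl⟩
      rw [h, hn, Complex.fractSMul_eq, hj, hl]
  filter_upwards [ae_all_iff.2 fun n => ae_all_iff.2 fun j => ae_all_iff.2 fun l => key n j l]
    with ω h
  exact h _ _ _ ⟨rfl, rfl, rfl⟩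

/-- A measure without point masses charges infinitely many pieces of some countable partition. -/
theorem exists_measurable_nat_frequently_measure_ne_zero (ν : Measure ℂ) (hν : ν ≠ 0)
    (hpt : ∀ v, ν {v} = 0) :
    ∃ N : ℂ → ℕ, Measurable N ∧ ∃ᶠ n in Filter.atTop, ν (N ⁻¹' {n}) ≠ 0 := by
  obtain ⟨c, -, hc⟩ := exists_mem_forall_mem_nhdsWithin_pos_measure (μ := ν) (s := Set.univ)
    (by rwa [Ne, Measure.measure_univ_eq_zero])
  rw [nhdsWithin_univ] at hc
  refine ⟨fun t => ⌊(dist t c)⁻¹⌋₊,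
    Nat.measurable_floor.comp (measurable_id.dist measurable_const).inv, fun h => ?_⟩
  simp only [not_not, Filter.eventually_atTop] at h
  obtain ⟨m, hm⟩ := h
  refine (hc (Metric.ball c ((m : ℝ) + 1)⁻¹) (Metric.ball_mem_nhds _ (by positivity))).ne' ?_
  -- The pieces are shells shrinking to `c`; were those with index at least `m` all null, a whole
  -- ball around `c` would be null.
  refine measure_mono_null (t := {c} ∪ ⋃ n : ℕ, ⋃ _ : m ≤ n,
    (fun t => ⌊(dist t c)⁻¹⌋₊) ⁻¹' {n}) (fun t ht => ?_) ?_
  · by_cases htc : t = c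
    · exact Or.inl htc
    · refine Or.inr (Set.mem_iUnion₂.2 ⟨_, ?_, rfl⟩)
      have hd : 0 < dist t c := dist_pos.2 htc
      have h1 := (lt_inv_comm₀ hd (by positivity)).1 (Metric.mem_ball.1 ht)
      exact Nat.le_floor (by linarith)
  · exact measure_union_null (hpt c)
      (measure_iUnion_null fun n => measure_iUnion_null fun hn => hm n hn)

end

/-- The image of a bounded set under a continuous linear map contains no line. -/
theorem Bornology.IsVonNBounded.exists_smul_notMem_image_smul {E : Type*} [AddCommGroup E]
    [Module ℂ E] [TopologicalSpace E] [T1Space E] {U : Set E} (hU : Bornology.IsVonNBounded ℂ U)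
    (T : E →ₗ[ℂ] E) (hT : Continuous T) {v : E} (hv : v ≠ 0) (n : ℕ) :
    ∃ r : ℝ, (r : ℂ) • v ∉ T '' (((n : ℂ) + 1) • U) := by
  -- This neighbourhood of `0` absorbs `U`, so `T '' U` misses `R • v` for some `R > 0`; then dilate
  -- by `n + 1`.
  have hW : T ⁻¹' {v}ᶜ ∈ 𝓝 (0 : E) :=
    hT.continuousAt (by rw [map_zero]; exact isOpen_compl_singleton.mem_nhds hv.symm)
  obtain ⟨R, hR, h⟩ := (hU hW).exists_pos
  have hR' := h (R : ℂ) (by simp [abs_of_pos hR])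
  refine ⟨((n : ℝ) + 1) * R, ?_⟩
  rintro ⟨-, ⟨u, hu, rfl⟩, hTu⟩
  obtain ⟨w, hw, rfl⟩ := hR' hu
  apply hw
  have hn : ((n : ℂ) + 1) ≠ 0 := by exact_mod_cast n.succ_ne_zero
  have hRc : (R : ℂ) ≠ 0 := by exact_mod_cast hR.ne'
  simp only [map_smul, smul_smul] at hTu
  push_cast at hTu
  exact smul_right_injective E (mul_ne_zero hn hRc) hTu

theorem eventually_mem_natCast_add_one_smul {E : Type*} [AddCommGroup E] [Module ℂ E]
    [TopologicalSpace E] [ContinuousSMul ℂ E] {U : Set E} (hU : U ∈ 𝓝 (0 : E)) (z : E) :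
    ∀ᶠ n : ℕ in Filter.atTop, z ∈ ((n : ℂ) + 1) • U := by
  have h : Filter.Tendsto (fun n : ℕ => (1 / ((n : ℂ) + 1)) • z) Filter.atTop (𝓝 0) := by
    simpa using (tendsto_one_div_add_atTop_nhds_zero_nat (𝕜 := ℂ)).smul_const z
  filter_upwards [h hU] with n hn
  have hn0 : ((n : ℂ) + 1) ≠ 0 := by exact_mod_cast n.succ_ne_zero
  exact ⟨_, hn, by simp [smul_smul, hn0]⟩

theorem proposition3p11 {Ω : Type*} [MeasurableSpace Ω] (μ : Measure Ω)
    (A : StarSubalgebra ℂ (Ω →ₘ[μ] ℂ)) (hA : LInfinity μ ≤ A)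
    {E : Type*} [AddCommGroup E] [Module ℂ E] [MetricSpace E]
    (M : WeakFrechetBimodule (LInfinity μ) E) (hE : IsLocallyBounded E)
    (i : BimoduleInclusion A hA M.toAlgebraBimodule)
    (D : Derivation ℂ A A) (x : A) : D x = 0 := by
  by_contra hx
  obtain ⟨U, hU0, hU⟩ := hE
  have := M.isFrechetSpace.continuous_smul
  have hα : Measurable (x.1 : Ω → ℂ) := AEEqFun.measurable x.1
  have hy : Measurable ((D x).1 : Ω → ℂ) := AEEqFun.measurable (D x).1
  set S : Set Ω := {ω | (D x).1 ω ≠ 0} with hS_def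
  have hS : MeasurableSet S := (hy (measurableSet_singleton 0)).compl
  have hSμ : μ S ≠ 0 := fun h => hx <| Subtype.ext <| AEEqFun.ext <| by
    filter_upwards [measure_eq_zero_iff_ae_notMem.1 h,
      AEEqFun.coeFn_zero (α := Ω) (μ := μ) (β := ℂ)] with ω h1 h2
    exact (not_not.1 h1).trans h2.symm
  obtain ⟨N, hN, hfreq⟩ := exists_measurable_nat_frequently_measure_ne_zero
    ((μ.restrict S).map x.1)
    (by rwa [Ne, Measure.map_eq_zero_iff hα.aemeasurable, Measure.restrict_eq_zero])
    (fun v => by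
      have hv : MeasurableSet ((x.1 : Ω → ℂ) ⁻¹' {v}) := hα (measurableSet_singleton v)
      rw [Measure.map_apply hα (measurableSet_singleton v), Measure.restrict_apply hv,
        measure_eq_zero_iff_ae_notMem]
      -- On `{x = v}` the function is constant: slope `0` forces `D x = 0` there.
      have h := D.ae_eq_of_affine_on hA x x 0 v hv
        (Filter.Eventually.of_forall fun ω hω => by simpa using hω)
      filter_upwards [h] with ω h hω
      exact hω.2 (by simpa using h hω.1))
  have hP : ∀ n, MeasurableSet {ω | N (x.1 ω) = n} := fun n =>
    (hN.comp hα) (measurableSet_singleton n)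
  let p : ℕ → LInfinity μ := fun n => LInfinity.indicator (hP n)
  have hr : ∀ n, ∃ r : ℝ, M.left (p n) (i.toLinearMap (D x)) ≠ 0 →
      (r : ℂ) • M.left (p n) (i.toLinearMap (D x)) ∉ M.left (p n) '' (((n : ℂ) + 1) • U) := by
    intro n
    by_cases hv : M.left (p n) (i.toLinearMap (D x)) = 0
    · exact ⟨0, fun h => (h hv).elim⟩
    · obtain ⟨r, hr⟩ := hU.exists_smul_notMem_image_smul _ (M.continuous_left (p n)) hv n
      exact ⟨r, fun _ => hr⟩
  choose r hr using hr
  obtain ⟨c, hc⟩ := D.exists_LInfinity_apply_ae_eq hA x (hN.comp hα) r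
  obtain ⟨n, hn, hz⟩ := (hfreq.and_eventually
    (eventually_mem_natCast_add_one_smul hU0 (i.toLinearMap (D c)))).exists
  -- For such `n`, the vector `D c` in the dilate of `U` is the forbidden preimage, as `p n · D c =
  -- r n • p n · D x`.
  refine hr n (fun h0 => hn ?_) ⟨_, hz, ?_⟩
  · rw [← i.map_left, map_eq_zero_iff _ i.injective] at h0
    have h0' : (p n).1 * (D x).1 = (p n).1 * 0 := by
      rw [mul_zero]
      exact congrArg Subtype.val h0
    rw [LInfinity.indicator_mul_eq_iff] at h0'
    rw [Measure.map_apply hα (hN (measurableSet_singleton n)),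
      Measure.restrict_apply (hα (hN (measurableSet_singleton n))),
      measure_eq_zero_iff_ae_notMem]
    filter_upwards [h0', AEEqFun.coeFn_zero (α := Ω) (μ := μ) (β := ℂ)] with ω h1 h2 hω
    exact hω.2 ((h1 hω.1).trans h2)
  · rw [← map_smul, ← i.toLinearMap.map_smul, ← i.map_left, ← i.map_left]
    congr 1
    apply Subtype.ext
    change (p n).1 * (D c).1 = (p n).1 * ((r n : ℂ) • (D x).1)
    rw [LInfinity.indicator_mul_eq_iff]
    filter_upwards [hc, AEEqFun.coeFn_smul (r n : ℂ) (D x).1] with ω h1 h2 hω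
    have hω' : N (x.1 ω) = n := hω
    rw [h1, h2, Function.comp_apply, hω']
    rfl
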